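/- Let $K$ be a compact Hausdorff space and let $C_a(K)$ be the vector space $C(K)$ of continuous real-valued functions on $K$ with the topology $\sigma(C(K),L)$, where $L$ is the cone of all finite nonnegative linear combinations of the evaluation functionals $\delta_x : f \mapsto f(x)$, $x \in K$; that is, the topology generated by the sets $\{ g \in C(K) : \max\{\varphi(g-f), 0\} < \varepsilon \}$ with $f \in C(K)$, $\varphi \in L$ and $\varepsilon > 0$. (Equivalently, a net $(f_\alpha)$ converges to $f$ in $C_a(K)$ if and only if $\limsup_\alpha f_\alpha(x) \le f(x)$ for all $x \in K$.) Let $B \subseteq C_a(K)$ be countably compact (every countable open cover of $B$ has a finite subcover) and regular in the subspace topology (every point of $B$ has a neighbourhood basis consisting of closed subsets of $B$; no separation axiom is included). Then $B$ is Fréchet-Urysohn: for every $A \subseteq B$, every point of the closure of $A$ in $B$ is the limit of a sequence in $A$. Moreover, $B$ is sequentially compact: every sequence in $B$ has a subsequence that converges to a point of $B$. -/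

import Mathlib

/-- The space `C_a(K)`: the real vector space `C(K)` of continuous real-valued functions on `K`,
to be equipped with the asymmetric pointwise topology (and not with the topology that Mathlib
puts on `C(K, ℝ)`). -/
def Ca (K : Type*) [TopologicalSpace K] : Type _ := C(K, ℝ)

namespace Ca

variable {K : Type*} [TopologicalSpace K]

instance : AddCommGroup (Ca K) := inferInstanceAs (AddCommGroup C(K, ℝ))

noncomputable instance : Module ℝ (Ca K) := inferInstanceAs (Module ℝ C(K, ℝ))

instance : FunLike (Ca K) K ℝ := inferInstanceAs (FunLike C(K, ℝ) K ℝ)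

/-- The evaluation functional `δ_x : f ↦ f x`. -/
noncomputable def delta (x : K) : Ca K →ₗ[ℝ] ℝ where
  toFun f := f x
  map_add' _ _ := rfl
  map_smul' _ _ := rfl

variable (K) in
/-- The cone `L` of all finite nonnegative linear combinations of evaluation functionals. -/
noncomputable def dualCone : PointedCone ℝ (Ca K →ₗ[ℝ] ℝ) :=
  PointedCone.hull ℝ (Set.range (delta (K := K)))

/-- The asymmetric seminorm `p_φ(f) = max {φ(f), 0}` of a linear functional `φ`. -/
noncomputable def asymSeminorm (φ : Ca K →ₗ[ℝ] ℝ) (f : Ca K) : ℝ := max (φ f) 0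

/-- The asymmetric pointwise topology `σ(C(K), L)`: the topology of the asymmetric seminorms
`p_φ` with `φ ∈ L`, generated by the balls `{g | p_φ (g - f) < ε}`. -/
instance : TopologicalSpace (Ca K) :=
  TopologicalSpace.generateFrom
    {U | ∃ f : Ca K, ∃ φ ∈ dualCone K, ∃ ε : ℝ, 0 < ε ∧ U = {g | asymSeminorm φ (g - f) < ε}}

theorem isOpen_eval_lt (x : K) (r : ℝ) : IsOpen {g : Ca K | g x < r} := by
  rw [isOpen_iff_mem_nhds]
  intro f hf
  have hf' : f x < r := hf
  have ho : IsOpen {g : Ca K | asymSeminorm (delta x) (g - f) < r - f x} :=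
    TopologicalSpace.isOpen_generateFrom_of_mem
      ⟨f, delta x, PointedCone.subset_hull ⟨x, rfl⟩, r - f x, by linarith, rfl⟩
  refine Filter.mem_of_superset (ho.mem_nhds ?_) ?_
  · simp [asymSeminorm, hf']
  · intro g hg
    have h1 : delta x (g - f) < r - f x := (max_lt_iff.1 hg).1
    rw [map_sub] at h1
    have h2 : g x - f x < r - f x := h1
    exact (by linarith : g x < r)

/-- Convergence in `C_a(K)`: `u → f` iff `limsup u(x) ≤ f(x)` for all `x` (the upper limit being
taken in the extended real line). -/
theorem tendsto_nhds_iff {ι : Type*} {l : Filter ι} {u : ι → Ca K} {f : Ca K} :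
    Filter.Tendsto u l (nhds f) ↔
      ∀ x, Filter.limsup (fun i => ((u i x : ℝ) : EReal)) l ≤ ((f x : ℝ) : EReal) := by
  have key : (∀ x, Filter.limsup (fun i => ((u i x : ℝ) : EReal)) l ≤ ((f x : ℝ) : EReal)) ↔
      ∀ x, ∀ ε : ℝ, 0 < ε → ∀ᶠ i in l, u i x < f x + ε := by
    refine forall_congr' fun x => ⟨fun h ε hε => ?_, fun h => ?_⟩
    · have h1 : Filter.limsup (fun i => ((u i x : ℝ) : EReal)) l < ((f x + ε : ℝ) : EReal) :=
        lt_of_le_of_lt h (EReal.coe_lt_coe_iff.2 (by linarith))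
      exact (Filter.eventually_lt_of_limsup_lt h1).mono fun i hi => EReal.coe_lt_coe_iff.1 hi
    · refine EReal.le_of_forall_lt_iff_le.1 fun z hz => ?_
      have hz' : f x < z := EReal.coe_lt_coe_iff.1 hz
      refine Filter.limsup_le_of_le (h := ?_)
      filter_upwards [h (z - f x) (by linarith)] with i hi
      exact EReal.coe_le_coe_iff.2 (by linarith)
  rw [key]
  constructor
  · intro h x ε hε
    exact h ((isOpen_eval_lt x (f x + ε)).mem_nhds (by simpa using hε))
  · intro h
    have hφ : ∀ φ ∈ dualCone K, ∀ ε : ℝ, 0 < ε → ∀ᶠ i in l, φ (u i) < φ f + ε := by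
      intro φ hφ
      refine Submodule.span_induction (p := fun φ _ => ∀ ε : ℝ, 0 < ε →
        ∀ᶠ i in l, φ (u i) < φ f + ε) ?_ ?_ ?_ ?_ hφ
      · rintro _ ⟨x, rfl⟩
        exact h x
      · intro ε hε
        simp [hε]
      · intro a b _ _ ha hb ε hε
        filter_upwards [ha (ε / 2) (by linarith), hb (ε / 2) (by linarith)] with i h1 h2
        simp only [LinearMap.add_apply]
        linarith
      · intro c a _ ha ε hε
        have hc : (0 : ℝ) ≤ c := c.2
        filter_upwards [ha (ε / (c + 1)) (by positivity)] with i hi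
        change (c : ℝ) * a (u i) < (c : ℝ) * a f + ε
        have h1 : (c : ℝ) * a (u i) ≤ c * (a f + ε / (c + 1)) :=
          mul_le_mul_of_nonneg_left hi.le hc
        have h2 : (c : ℝ) * (ε / (c + 1)) < ε := by
          rw [mul_div_assoc', div_lt_iff₀ (by positivity)]
          nlinarith
        nlinarith
    refine TopologicalSpace.tendsto_nhds_generateFrom_iff.2 ?_
    rintro _ ⟨g, φ, hm, ε, hε, rfl⟩ hfg
    have hfg' : φ (f - g) < ε := (max_lt_iff.1 hfg).1
    rw [map_sub] at hfg'
    filter_upwards [hφ φ hm (ε - (φ f - φ g)) (by linarith)] with i hi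
    refine max_lt_iff.2 ⟨?_, hε⟩
    rw [map_sub]
    linarith

end Ca

open Filter Topology Set

namespace Ca

variable {K : Type*} [TopologicalSpace K]

/-! Basic neighbourhoods of `f` bound values from above at finitely many points only. Choose `g n ∈
A n` in shrinking closed neighbourhoods `V n` of `f` that give such bounds on finite sets `F n`,
where `F n` imitates every point of `K` for `f` and the earlier `g i`. If `g` fails to converge at
`x`, some subsequence stays at least `f x + ε` there; let `h` be a cluster point of it. Points of `F
n` imitating `x` accumulate at some `z` with `f z = f x` and `g i z = g i x` for all `i`, while `h z
≤ f z` because `h` lies in every `V n`. So some term of the subsequence is below `f x + ε` at `x`, a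
contradiction. -/

theorem continuous_coe (f : Ca K) : Continuous (f : K → ℝ) :=
  ContinuousMap.continuous (show C(K, ℝ) from f)

/-- Finitely many continuous functions on a compact space are simultaneously approximated by their
values on a finite set of points. -/
theorem exists_finset_approx [CompactSpace K] (S : Finset (Ca K)) {δ : ℝ} (hδ : 0 < δ) :
    ∃ F : Finset K, ∀ x, ∃ y ∈ F, ∀ g ∈ S, |g y - g x| < δ := by
  obtain ⟨F, hF⟩ := CompactSpace.elim_nhds_subcover (fun y => {x | ∀ g ∈ S, |g y - g x| < δ}) (by
    intro y
    have h : ∀ᶠ x in 𝓝 y, ∀ g ∈ S, |g y - g x| < δ := by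
      refine (Finset.eventually_all S).2 fun g _ => ?_
      have hc : ContinuousAt (fun x => |g y - g x|) y :=
        (continuous_const.sub (continuous_coe g)).abs.continuousAt
      exact hc.eventually_lt_const (by simpa using hδ)
    exact h)
  refine ⟨F, fun x => ?_⟩
  have hx : x ∈ ⋃ y ∈ F, {x | ∀ g ∈ S, |g y - g x| < δ} := hF ▸ mem_univ x
  simpa using hx

theorem tendsto_nhds_of_eventually_lt {ι : Type*} {l : Filter ι} {u : ι → Ca K} {f : Ca K}
    (h : ∀ x, ∀ ε : ℝ, 0 < ε → ∀ᶠ i in l, u i x < f x + ε) : Tendsto u l (𝓝 f) := by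
  refine tendsto_nhds_iff.2 fun x => EReal.le_of_forall_lt_iff_le.1 fun z hz => ?_
  have hz' : f x < z := EReal.coe_lt_coe_iff.1 hz
  refine limsup_le_of_le (h := ?_)
  filter_upwards [h x (z - f x) (by linarith)] with i hi
  exact EReal.coe_le_coe_iff.2 (by linarith)

/-- In a regular subspace, a point of the closures of all `A n` admits a sequence of points of the
`A n`, together with shrinking closed neighbourhoods and finite sets of test points on which the
earlier terms of the sequence are well approximated. -/
theorem exists_seq_closed_nhds_approx [CompactSpace K] {B : Set (Ca K)} [RegularSpace B] (f : B)
    (A : ℕ → Set B) (hA : ∀ n, f ∈ closure (A n)) :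
    ∃ (g : ℕ → B) (V : ℕ → Set B) (F : ℕ → Finset K), Antitone V ∧ (∀ n, IsClosed (V n)) ∧
      (∀ n, g n ∈ A n) ∧ (∀ n, g n ∈ V n) ∧
      (∀ n, ∀ h ∈ V n, ∀ y ∈ F n, (h : Ca K) y < (f : Ca K) y + 1 / ((n : ℝ) + 1)) ∧
      ∀ n x, ∃ y ∈ F n, |(f : Ca K) y - (f : Ca K) x| < 1 / ((n : ℝ) + 1) ∧
        ∀ i < n, |(g i : Ca K) y - (g i : Ca K) x| < 1 / ((n : ℝ) + 1) := by
  classical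
  have step : ∀ (n : ℕ) (s : Finset (Ca K) × {V : Set B // V ∈ 𝓝 f ∧ IsClosed V}),
      ∃ (g : B) (V : {V : Set B // V ∈ 𝓝 f ∧ IsClosed V}) (F : Finset K),
        V.1 ⊆ s.2.1 ∧ g ∈ A n ∧ g ∈ V.1 ∧
        (∀ h ∈ V.1, ∀ y ∈ F, (h : Ca K) y < (f : Ca K) y + 1 / ((n : ℝ) + 1)) ∧
        ∀ x, ∃ y ∈ F, ∀ h ∈ insert (f : Ca K) s.1, |h y - h x| < 1 / ((n : ℝ) + 1) := by
    intro n s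
    have hn : (0 : ℝ) < 1 / ((n : ℝ) + 1) := by positivity
    obtain ⟨F, hF⟩ := exists_finset_approx (insert (f : Ca K) s.1) hn
    have hU : ∀ᶠ h : B in 𝓝 f, ∀ y ∈ F, (h : Ca K) y < (f : Ca K) y + 1 / ((n : ℝ) + 1) :=
      (Finset.eventually_all F).2 fun y _ =>
        ((isOpen_eval_lt y _).preimage continuous_subtype_val).mem_nhds
          (show (f : Ca K) y < (f : Ca K) y + 1 / ((n : ℝ) + 1) by linarith)
    obtain ⟨V, hV, hVc, hVs⟩ := exists_mem_nhds_isClosed_subset (inter_mem s.2.2.1 hU)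
    obtain ⟨g, hgV, hgA⟩ := mem_closure_iff_nhds.1 (hA n) V hV
    exact ⟨g, ⟨V, hV, hVc⟩, F, fun h hh => (hVs hh).1, hgA, hgV, fun h hh => (hVs hh).2, hF⟩
  choose g V F hVs hgA hgV hVF hF using step
  -- The state before stage `n`: the functions chosen so far and the last closed neighbourhood.
  let s : ℕ → Finset (Ca K) × {V : Set B // V ∈ 𝓝 f ∧ IsClosed V} := fun n =>
    Nat.rec (∅, ⟨univ, univ_mem, isClosed_univ⟩) (fun n s => (insert (g n s : Ca K) s.1, V n s)) n
  have hs : ∀ n, ∀ i < n, (g i (s i) : Ca K) ∈ (s n).1 := by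
    intro n
    induction n with
    | zero => intro i hi; omega
    | succ n ih =>
      intro i hi
      change _ ∈ insert (g n (s n) : Ca K) (s n).1
      rcases Nat.lt_succ_iff_lt_or_eq.1 hi with h | rfl
      · exact Finset.mem_insert_of_mem (ih i h)
      · exact Finset.mem_insert_self _ _
  refine ⟨fun n => g n (s n), fun n => (V n (s n)).1, fun n => F n (s n),
    antitone_nat_of_succ_le fun n => hVs (n + 1) (s (n + 1)), fun n => (V n (s n)).2.2,
    fun n => hgA n _, fun n => hgV n _, fun n => hVF n _, fun n x => ?_⟩
  obtain ⟨y, hy, h⟩ := hF n (s n) x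
  exact ⟨y, hy, h _ (Finset.mem_insert_self _ _),
    fun i hi => h _ (Finset.mem_insert_of_mem (hs n i hi))⟩

/-- In a countably compact regular subspace of `C_a(K)`, a point of the closures of all `A n` is the
limit of a sequence with `n`-th term in `A n`. -/
theorem exists_seq_tendsto_of_mem_closure [CompactSpace K] {B : Set (Ca K)} [RegularSpace B]
    [CountablyCompactSpace B] (f : B) (A : ℕ → Set B) (hA : ∀ n, f ∈ closure (A n)) :
    ∃ g : ℕ → B, (∀ n, g n ∈ A n) ∧ Tendsto g atTop (𝓝 f) := by
  obtain ⟨g, V, F, hV, hVc, hgA, hgV, hVF, hF⟩ := exists_seq_closed_nhds_approx f A hA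
  refine ⟨g, hgA, tendsto_subtype_rng.2 (tendsto_nhds_of_eventually_lt fun x ε hε => ?_)⟩
  by_contra hcon
  obtain ⟨φ, hφ, hgφ⟩ := extraction_of_frequently_atTop (not_eventually.1 hcon)
  obtain ⟨h, -, hh⟩ := CountablyCompactSpace.isCountablyCompact_univ.seq_clusterPt (g ∘ φ)
    (Eventually.of_forall fun _ => mem_univ _)
  -- Regularity pays off here: closed neighbourhoods retain cluster points.
  have hhV : ∀ n, h ∈ V n := fun n => (hVc n).mem_of_mapClusterPt hh <| by
    filter_upwards [hφ.tendsto_atTop.eventually_ge_atTop n] with i hi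
    exact hV hi (hgV _)
  choose y hyF hyf hyg using fun n => hF n x
  have hlim : Tendsto (fun n : ℕ => 1 / ((n : ℝ) + 1)) atTop (𝓝 0) :=
    tendsto_one_div_add_atTop_nhds_zero_nat
  have hfx : Tendsto (fun n => (f : Ca K) (y n)) atTop (𝓝 ((f : Ca K) x)) :=
    tendsto_iff_norm_sub_tendsto_zero.2
      (squeeze_zero (fun _ => norm_nonneg _) (fun n => (hyf n).le) hlim)
  have hgx : ∀ i, Tendsto (fun n => (g i : Ca K) (y n)) atTop (𝓝 ((g i : Ca K) x)) := fun i =>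
    tendsto_iff_norm_sub_tendsto_zero.2
      (squeeze_zero' (Eventually.of_forall fun _ => norm_nonneg _)
        ((eventually_gt_atTop i).mono fun n hn => (hyg n i hn).le) hlim)
  -- `K` need not be sequentially compact, so `z` is a limit along a free ultrafilter.
  have hle : (hyperfilter ℕ : Filter ℕ) ≤ atTop := Nat.hyperfilter_le_atTop
  obtain ⟨z, -, hz⟩ := isCompact_univ.ultrafilter_le_nhds ((hyperfilter ℕ).map y) (by simp)
  have hyz : Tendsto y (hyperfilter ℕ) (𝓝 z) := hz
  have hval : ∀ p : Ca K, Tendsto (fun n => p (y n)) (hyperfilter ℕ) (𝓝 (p z)) := fun p =>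
    ((continuous_coe p).tendsto z).comp hyz
  have hfz : (f : Ca K) z = (f : Ca K) x := tendsto_nhds_unique (hval f) (hfx.mono_left hle)
  have hgz : ∀ i, (g i : Ca K) z = (g i : Ca K) x := fun i =>
    tendsto_nhds_unique (hval (g i)) ((hgx i).mono_left hle)
  have hupper : (h : Ca K) z ≤ (f : Ca K) z := by
    have hadd := (hval f).add (hlim.mono_left hle)
    rw [add_zero] at hadd
    exact le_of_tendsto_of_tendsto' (hval h) hadd fun n => (hVF n h (hhV n) _ (hyF n)).le
  have hlt : ∀ᶠ p : B in 𝓝 h, (p : Ca K) z < (f : Ca K) z + ε :=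
    ((isOpen_eval_lt z _).preimage continuous_subtype_val).mem_nhds
      (show (h : Ca K) z < (f : Ca K) z + ε by linarith)
  obtain ⟨n, hn⟩ := (hh.frequently hlt).exists
  rw [Function.comp_apply, hgz, hfz] at hn
  exact hgφ n hn

end Ca

theorem mainTheorem1 {K : Type*} [TopologicalSpace K] [CompactSpace K] [T2Space K]
    (B : Set (Ca K)) (hB : IsCountablyCompact B) (hreg : RegularSpace B) :
    FrechetUrysohnSpace B ∧ IsSeqCompact B := by
  have : CountablyCompactSpace B := isCountablyCompact_iff_countablyCompactSpace.1 hB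
  refine ⟨⟨fun s f hf => Ca.exists_seq_tendsto_of_mem_closure f (fun _ => s) fun _ => hf⟩, ?_⟩
  intro u hu
  let v : ℕ → B := fun n => ⟨u n, hu n⟩
  obtain ⟨f, -, hf⟩ := CountablyCompactSpace.isCountablyCompact_univ.seq_clusterPt v
    (Eventually.of_forall fun _ => mem_univ _)
  -- Taking tails as the sets `A n` forces indices `ψ n ≥ n`, so a strictly increasing subsequence
  -- of `ψ` exists.
  obtain ⟨g, hg, hgf⟩ := Ca.exists_seq_tendsto_of_mem_closure f (fun n => v '' Ici n) fun n =>
    isClosed_closure.mem_of_mapClusterPt hf <| (eventually_ge_atTop n).mono fun i hi =>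
      subset_closure (mem_image_of_mem v hi)
  choose ψ hψ hψg using hg
  obtain ⟨φ, hφ, hψφ⟩ := strictMono_subseq_of_id_le hψ
  refine ⟨f, f.2, ψ ∘ φ, hψφ, ?_⟩
  have hlim := tendsto_subtype_rng.1 (hgf.comp hφ.tendsto_atTop)
  refine hlim.congr fun n => ?_
  simp only [Function.comp_apply, ← hψg, v]
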